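/- Let $d\ge 1$, let $\mathcal X\subset\mathbb R^d$ carry the Euclidean distance, its Borel $\sigma$-algebra and a Borel probability measure $\nu$, and let $f:\mathcal X\to\mathcal X$ be measurable. Suppose that $f$ preserves $\nu$, that $\nu$ is ergodic for $f$, and that $\nu$ is absolutely continuous with respect to Lebesgue measure. Write $B(x,r)$ for the ball in $\mathcal X$, and let $\tilde x\in\mathcal X$ satisfy the following. (A2) There are $\delta>0$, $r_0>0$ and $C$ such that $|\nu(B(\tilde x,r+\epsilon))-\nu(B(\tilde x,r))|\le C\epsilon^{\delta}$ for all $0<\epsilon<r<r_0$. (Local dimension and density.) The local dimension $d_\nu=\lim_{r\to0}\log\nu(B(\tilde x,r))/\log r$ exists, and there are $0<c\le C'$ and $r_1>0$ such that $c\,r^{d_\nu}\le\nu(B(\tilde x,r))\le C'r^{d_\nu}$ for $0<r<r_1$. (This holds with $d_\nu=d$ whenever $\nu$ has a positive finite density at $\tilde x$, i.e. whenever $\nu(B(\tilde x,r))$ divided by the Lebesgue measure of the ball of radius $r$ about $\tilde x$ in $\mathbb R^d$ tends to a limit in $(0,\infty)$ as $r\to0$.) (A1) There is a monotonically decreasing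 sequence $\Theta(j)\to0$ such that for all bounded Lipschitz $\varphi_1,\varphi_2:\mathcal X\to\mathbb R$ and all $j\ge 0$, $$\Big|\int\varphi_1\cdot\varphi_2\circ f^j\,d\nu-\int\varphi_1\,d\nu\int\varphi_2\,d\nu\Big|\le\Theta(j)\,\|\varphi_1\|_{\mathrm{Lip}}\|\varphi_2\|_{\mathrm{Lip}},\qquad \|\varphi\|_{\mathrm{Lip}}=\sup|\varphi|+\mathrm{Lip}(\varphi),$$ where $\mathrm{Lip}(\varphi)$ is the least Lipschitz constant of $\varphi$. Let $\phi(x)=-\log\operatorname{dist}(x,\tilde x)$ (with $\phi(\tilde x)=+\infty$) and $M_n(x)=\max_{0\le i<n}\phi(f^i(x))$. 1. If $\Theta(n)=O(\theta_0^n)$ for some $\theta_0\in(0,1)$, then there is $\beta>0$ such that for every $\eta>1$, for $\nu$-almost every $x$, for all sufficiently large $n$ (depending on $x$), $$d_\nu^{-1}(\log n-\beta\log\log n)\le M_n(x)\le d_\nu^{-1}(\log n+\eta\log\log n).$$ 2. If $\Theta(n)=O(n^{-\zeta})$ for some $\zeta>2\delta^{-1}$, with $\delta$ the exponent in (A2),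 then there is $\beta>0$ such that for every $\eta>1$, for $\nu$-almost every $x$, for all sufficiently large $n$ (depending on $x$), $$d_\nu^{-1}\beta\log n\le M_n(x)\le d_\nu^{-1}(\log n+\eta\log\log n).$$ -/

import Mathlib

open Filter Topology MeasureTheory Asymptotics

noncomputable section

namespace MaxProcess

/-- The bounded real-valued Lipschitz functions on a metric space. -/
def IsBoundedLipschitz {X : Type*} [MetricSpace X] (φ : X → ℝ) : Prop :=
  (∃ K : NNReal, LipschitzWith K φ) ∧ ∃ B : ℝ, ∀ x, |φ x| ≤ B

/-- The norm `sup |φ| + Lip(φ)` of a bounded Lipschitz function, where `Lip(φ)` is the smallest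
Lipschitz constant. -/
def lipNorm {X : Type*} [MetricSpace X] (φ : X → ℝ) : ℝ :=
  (⨆ x, |φ x|) + sInf {K : ℝ | 0 ≤ K ∧ ∀ x y, |φ x - φ y| ≤ K * dist x y}

/-- The correlation `|∫ φ₁ · φ₂ ∘ f^j dν - ∫ φ₁ dν ∫ φ₂ dν|`. -/
def correlation {X : Type*} [MeasurableSpace X] (f : X → X) (ν : Measure X) (j : ℕ)
    (φ₁ φ₂ : X → ℝ) : ℝ :=
  |(∫ x, φ₁ x * φ₂ (f^[j] x) ∂ν) - (∫ x, φ₁ x ∂ν) * ∫ x, φ₂ x ∂ν|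

/-- Decay of correlations for Lipschitz functions against Lipschitz functions, with the
monotonically decreasing rate function `Θ → 0`. -/
structure DecayOfCorrelations {X : Type*} [MetricSpace X] [MeasurableSpace X] (f : X → X)
    (ν : Measure X) (Θ : ℕ → ℝ) : Prop where
  antitone : Antitone Θ
  tendsto_zero : Tendsto Θ atTop (𝓝 0)
  bound : ∀ φ₁ φ₂ : X → ℝ, IsBoundedLipschitz φ₁ → IsBoundedLipschitz φ₂ →
    ∀ j, correlation f ν j φ₁ φ₂ ≤ Θ j * lipNorm φ₁ * lipNorm φ₂

/-- Regularity of `ν` on shrinking annuli about `z`, with exponent `δ > 0`. -/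
def AnnulusRegular {X : Type*} [MetricSpace X] [MeasurableSpace X] (ν : Measure X) (z : X)
    (δ : ℝ) : Prop :=
  0 < δ ∧ ∃ C r₀ : ℝ, 0 < r₀ ∧ ∀ ε r : ℝ, 0 < ε → ε < r → r < r₀ →
    |ν.real (Metric.ball z (r + ε)) - ν.real (Metric.ball z r)| ≤ C * ε ^ δ

/-- The local dimension of `ν` at `z` exists and equals `s`. -/
def HasLocalDim {X : Type*} [MetricSpace X] [MeasurableSpace X] (ν : Measure X) (z : X)
    (s : ℝ) : Prop :=
  Tendsto (fun r : ℝ => Real.log (ν.real (Metric.ball z r)) / Real.log r) (𝓝[>] 0) (𝓝 s)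

/-- The measure of a small ball of radius `r` about `z` is comparable to `r ^ s`.
If `ν` is a measure on a subset of `ℝ^d` that has a positive finite density at `z` with respect
to Lebesgue measure, this holds with `s = d`. -/
def BallComparable {X : Type*} [MetricSpace X] [MeasurableSpace X] (ν : Measure X) (z : X)
    (s : ℝ) : Prop :=
  ∃ c C r₁ : ℝ, 0 < c ∧ 0 < r₁ ∧ ∀ r : ℝ, 0 < r → r < r₁ →
    c * r ^ s ≤ ν.real (Metric.ball z r) ∧ ν.real (Metric.ball z r) ≤ C * r ^ s

/-- The observable `-log dist(x, z)`, with its true value `+∞` at `x = z`. -/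
def logObs {X : Type*} [MetricSpace X] (z x : X) : EReal :=
  -ENNReal.log (edist x z)

/-- `maxProc f φ n x = max (X₁(x), …, Xₙ(x))` with `Xᵢ = φ ∘ f^(i-1)`. -/
def maxProc {X : Type*} (f : X → X) (φ : X → EReal) (n : ℕ) (x : X) : EReal :=
  (Finset.range n).sup fun i => φ (f^[i] x)

end MaxProcess

end

/-! `M_n` is at least `c` exactly when the orbit segment of length `n` enters the closed ball of
radius `exp (-c)` about `z`, so both bounds are Borel–Cantelli estimates for entry probabilities.
They are made along `n = 4 ^ k` and extended to all `n` by monotonicity of `M_n`.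

Upper bound: by invariance and a union bound, entering a ball of radius `r` within `n` steps has
probability at most `n * ν(B(z, r))`, of order `n * r ^ s`. With the stated threshold this is of
order `k ^ (-η)` along `4 ^ k`, which is summable since `η > 1`.

Lower bound: replace the ball by a Lipschitz bump `g` with mean `p ≥ ν(B(z, r / 2))`. If the orbit
misses the ball, the Birkhoff sum of `g` is `0`, at distance `n * p` from its mean, so Chebyshev
applies (`measureReal_forall_eq_zero_le`). In the variance, pairs of times closer than `m` cost at
most `p` each, and the others are controlled by decay of correlations. This gives `2m / (np) + Θ(m)
‖g‖² / p²`; the gap `m` is then chosen to make both terms summable: linear in `k` for exponential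
decay, `2 ^ k` for polynomial decay. -/

namespace MaxProcess

/-! ### The maximum in terms of distances to `z`. -/

section Observable

variable {X : Type*} [MetricSpace X]

theorem coe_le_logObs_iff {z x : X} {c : ℝ} :
    (c : EReal) ≤ logObs z x ↔ dist x z ≤ Real.exp (-c) := by
  have h : ((-c : ℝ) : EReal) = ENNReal.log (ENNReal.ofReal (Real.exp (-c))) := by
    rw [ENNReal.log_ofReal_of_pos (Real.exp_pos _), Real.log_exp]
  rw [logObs, EReal.le_neg, ← EReal.coe_neg, h, ENNReal.log_le_log_iff, edist_dist,
    ENNReal.ofReal_le_ofReal_iff (Real.exp_pos _).le]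

theorem logObs_le_coe_iff {z x : X} {c : ℝ} :
    logObs z x ≤ (c : EReal) ↔ Real.exp (-c) ≤ dist x z := by
  have h : ((-c : ℝ) : EReal) = ENNReal.log (ENNReal.ofReal (Real.exp (-c))) := by
    rw [ENNReal.log_ofReal_of_pos (Real.exp_pos _), Real.log_exp]
  rw [logObs, EReal.neg_le, ← EReal.coe_neg, h, ENNReal.log_le_log_iff, edist_dist,
    ENNReal.ofReal_le_ofReal_iff dist_nonneg]

theorem maxProc_mono {Y : Type*} (f : Y → Y) (φ : Y → EReal) (x : Y) :
    Monotone fun n => maxProc f φ n x := fun _ _ h =>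
  Finset.sup_mono (Finset.range_mono h)

theorem maxProc_logObs_le_coe {f : X → X} {z x : X} {n : ℕ} {c : ℝ}
    (h : ∀ i < n, Real.exp (-c) ≤ dist (f^[i] x) z) :
    maxProc f (logObs z) n x ≤ (c : EReal) :=
  Finset.sup_le fun i hi => logObs_le_coe_iff.2 (h i (Finset.mem_range.1 hi))

theorem coe_le_maxProc_logObs {f : X → X} {z x : X} {n i : ℕ} {c : ℝ} (hi : i < n)
    (h : dist (f^[i] x) z ≤ Real.exp (-c)) :
    (c : EReal) ≤ maxProc f (logObs z) n x :=
  (coe_le_logObs_iff.2 h).trans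
    (Finset.le_sup (f := fun i => logObs z (f^[i] x)) (Finset.mem_range.2 hi))

end Observable

/-! ### Lipschitz approximations of balls. -/

section Bump

variable {X : Type*} [MetricSpace X]

/-- A Lipschitz function which is `1` on the ball of radius `r / 2` about `z` and vanishes off the
ball of radius `r`. -/
noncomputable def bump (z : X) (r : ℝ) (x : X) : ℝ := max 0 (min 1 (2 - 2 / r * dist x z))

theorem bump_nonneg (z : X) (r : ℝ) (x : X) : 0 ≤ bump z r x := le_max_left _ _

theorem bump_le_one (z : X) (r : ℝ) (x : X) : bump z r x ≤ 1 :=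
  max_le zero_le_one (min_le_left _ _)

theorem bump_eq_zero {z x : X} {r : ℝ} (hr : 0 < r) (h : r ≤ dist x z) : bump z r x = 0 := by
  refine max_eq_left ((min_le_right _ _).trans ?_)
  have : 2 ≤ 2 / r * dist x z := by
    rw [div_mul_eq_mul_div, le_div_iff₀ hr]; linarith
  linarith

theorem bump_eq_one {z x : X} {r : ℝ} (hr : 0 < r) (h : dist x z < r / 2) : bump z r x = 1 := by
  have : 2 / r * dist x z ≤ 1 := by
    rw [div_mul_eq_mul_div, div_le_iff₀ hr]; linarith
  rw [bump, min_eq_left (by linarith), max_eq_right zero_le_one]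

theorem abs_bump_sub_le (z : X) {r : ℝ} (hr : 0 < r) (x y : X) :
    |bump z r x - bump z r y| ≤ 2 / r * dist x y := by
  refine (abs_max_sub_max_le_max _ _ _ _).trans ?_
  have h2 : 0 ≤ 2 / r * dist x y := by positivity
  refine max_le (by simpa using h2) ((abs_min_sub_min_le_max _ _ _ _).trans ?_)
  refine max_le (by simpa using h2) ?_
  have h3 : 2 - 2 / r * dist x z - (2 - 2 / r * dist y z) = 2 / r * (dist y z - dist x z) := by
    ring
  rw [h3, abs_mul, abs_of_pos (by positivity : 0 < 2 / r)]
  gcongr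
  rw [dist_comm x y]
  exact abs_dist_sub_le y x z

theorem isBoundedLipschitz_bump (z : X) {r : ℝ} (hr : 0 < r) : IsBoundedLipschitz (bump z r) := by
  refine ⟨⟨Real.toNNReal (2 / r), LipschitzWith.of_dist_le_mul fun x y => ?_⟩, 1, fun x => ?_⟩
  · rw [Real.coe_toNNReal _ (by positivity), Real.dist_eq]
    exact abs_bump_sub_le z hr x y
  · rw [abs_of_nonneg (bump_nonneg z r x)]
    exact bump_le_one z r x

theorem continuous_bump (z : X) {r : ℝ} (hr : 0 < r) : Continuous (bump z r) :=
  (isBoundedLipschitz_bump z hr).1.choose_spec.continuous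

theorem lipNorm_nonneg (φ : X → ℝ) : 0 ≤ lipNorm φ :=
  add_nonneg (Real.iSup_nonneg fun _ => abs_nonneg _) (Real.sInf_nonneg fun _ h => h.1)

theorem lipNorm_bump_le (z : X) {r : ℝ} (hr : 0 < r) : lipNorm (bump z r) ≤ 1 + 2 / r := by
  have : Nonempty X := ⟨z⟩
  refine add_le_add (ciSup_le fun x => ?_)
    (csInf_le ⟨0, fun _ h => h.1⟩ ⟨by positivity, abs_bump_sub_le z hr⟩)
  rw [abs_of_nonneg (bump_nonneg z r x)]
  exact bump_le_one z r x

end Bump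

/-! ### Variance of Birkhoff sums and Chebyshev's inequality. -/

section SecondMoment

theorem card_filter_near_le (n m i : ℕ) :
    ((Finset.range n).filter fun j => i < j + m ∧ j < i + m).card ≤ 2 * m := by
  have h : ((Finset.range n).filter fun j => i < j + m ∧ j < i + m) ⊆
      Finset.Ico (i + 1 - m) (i + m) := by
    intro j hj
    simp only [Finset.mem_filter, Finset.mem_Ico] at hj ⊢
    omega
  refine (Finset.card_le_card h).trans ?_
  rw [Nat.card_Ico]
  omega

theorem sum_sum_near_le (n m : ℕ) {p T : ℝ} (hp : 0 ≤ p) (hT : 0 ≤ T) :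
    ∑ i ∈ Finset.range n, ∑ j ∈ Finset.range n, (if i < j + m ∧ j < i + m then p else T) ≤
      2 * n * m * p + (n : ℝ) ^ 2 * T := by
  have h : ∀ i ∈ Finset.range n,
      ∑ j ∈ Finset.range n, (if i < j + m ∧ j < i + m then p else T) ≤ 2 * m * p + n * T := by
    intro i _
    rw [Finset.sum_ite, Finset.sum_const, Finset.sum_const, nsmul_eq_mul, nsmul_eq_mul]
    refine add_le_add (mul_le_mul_of_nonneg_right ?_ hp) (mul_le_mul_of_nonneg_right ?_ hT)
    · exact_mod_cast card_filter_near_le n m i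
    · exact_mod_cast (Finset.card_filter_le _ _).trans (Finset.card_range n).le
  refine (Finset.sum_le_sum h).trans (le_of_eq ?_)
  rw [Finset.sum_const, Finset.card_range, nsmul_eq_mul]
  ring

variable {X : Type*} [MeasurableSpace X] {ν : Measure X}
  {f : X → X}

theorem integral_comp_iterate (hf : MeasurePreserving f ν ν) {h : X → ℝ} (hh : Measurable h)
    (i : ℕ) : ∫ x, h (f^[i] x) ∂ν = ∫ x, h x ∂ν := by
  have := integral_map (μ := ν) (hf.iterate i).measurable.aemeasurable
    (f := h) hh.aestronglyMeasurable
  rw [← this, (hf.iterate i).map_eq]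

variable [IsProbabilityMeasure ν]

theorem integrable_of_mem_unitInterval {g : X → ℝ} (hg : Measurable g) (h0 : ∀ x, 0 ≤ g x)
    (h1 : ∀ x, g x ≤ 1) : Integrable g ν :=
  Integrable.of_bound hg.aestronglyMeasurable 1
    (ae_of_all _ fun x => by rw [Real.norm_of_nonneg (h0 x)]; exact h1 x)

/-- By invariance the covariance depends only on the gap between `i` and `j`. Short gaps need no
mixing: `0 ≤ g ≤ 1` already bounds the covariance by `p - p²`. -/
theorem integral_centered_mul_le (hf : MeasurePreserving f ν ν) {g : X → ℝ} (hg : Measurable g)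
    (h0 : ∀ x, 0 ≤ g x) (h1 : ∀ x, g x ≤ 1) {m : ℕ} {T : ℝ}
    (hT : ∀ k, m ≤ k → correlation f ν k g g ≤ T) (i j : ℕ) :
    ∫ x, (g (f^[i] x) - ∫ y, g y ∂ν) * (g (f^[j] x) - ∫ y, g y ∂ν) ∂ν ≤
      if i < j + m ∧ j < i + m then ∫ y, g y ∂ν else T := by
  wlog hij : i ≤ j generalizing i j
  · have := this j i (by omega)
    simpa only [mul_comm, and_comm] using this
  set p := ∫ y, g y ∂ν with hp
  have hp0 : 0 ≤ p := integral_nonneg h0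
  obtain ⟨k, rfl⟩ := Nat.exists_eq_add_of_le hij
  have hgk : ∀ l, Measurable fun x => g (f^[l] x) := fun l =>
    hg.comp (hf.iterate l).measurable
  have hint : ∀ l, Integrable (fun x => g (f^[l] x)) ν := fun l =>
    integrable_of_mem_unitInterval (hgk l) (fun _ => h0 _) fun _ => h1 _
  have hint2 : Integrable (fun x => g x * g (f^[k] x)) ν :=
    integrable_of_mem_unitInterval (hg.mul (hgk k)) (fun _ => mul_nonneg (h0 _) (h0 _))
      fun _ => mul_le_one₀ (h1 _) (h0 _) (h1 _)
  have hmeas : Measurable fun x => (g x - p) * (g (f^[k] x) - p) :=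
    (hg.sub_const p).mul ((hgk k).sub_const p)
  have hshift : ∫ x, (g (f^[i] x) - p) * (g (f^[i + k] x) - p) ∂ν =
      ∫ x, (g x - p) * (g (f^[k] x) - p) ∂ν := by
    rw [← integral_comp_iterate hf hmeas i]
    refine integral_congr_ae (ae_of_all _ fun x => ?_)
    simp only [← Function.iterate_add_apply, add_comm k i]
  have hcov : ∫ x, (g x - p) * (g (f^[k] x) - p) ∂ν = ∫ x, g x * g (f^[k] x) ∂ν - p * p := by
    have e : (fun x => (g x - p) * (g (f^[k] x) - p)) = fun x =>
        g x * g (f^[k] x) - p * g x - (p * g (f^[k] x) - p * p) := by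
      ext x; ring
    have i1 : Integrable (fun x => p * g x) ν := (hint 0).const_mul p
    have i2 : Integrable (fun x => p * g (f^[k] x)) ν := (hint k).const_mul p
    have i3 : Integrable (fun x => g x * g (f^[k] x) - p * g x) ν := hint2.sub i1
    have i4 : Integrable (fun x => p * g (f^[k] x) - p * p) ν := i2.sub (integrable_const _)
    rw [e, integral_sub i3 i4, integral_sub hint2 i1, integral_sub i2 (integrable_const _),
      integral_const_mul, integral_const_mul, integral_comp_iterate hf hg k, ← hp]
    simp
  rw [hshift, hcov]
  split_ifs with hc
  · have : ∫ x, g x * g (f^[k] x) ∂ν ≤ p :=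
      integral_mono hint2 (hint 0) fun x => mul_le_of_le_one_right (h0 _) (h1 _)
    nlinarith
  · have hk : m ≤ k := by omega
    exact (le_abs_self _).trans (hT k hk)

/-- Second moment bound for the probability that a `[0, 1]`-valued observable vanishes along an
orbit segment of length `n`. -/
theorem measureReal_forall_eq_zero_le (hf : MeasurePreserving f ν ν) {g : X → ℝ}
    (hg : Measurable g) (h0 : ∀ x, 0 ≤ g x) (h1 : ∀ x, g x ≤ 1) {m n : ℕ} (hn : 0 < n) {T : ℝ}
    (hT : ∀ k, m ≤ k → correlation f ν k g g ≤ T) (hp : 0 < ∫ y, g y ∂ν) :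
    ν.real {x | ∀ i < n, g (f^[i] x) = 0} ≤
      2 * m / (n * ∫ y, g y ∂ν) + T / (∫ y, g y ∂ν) ^ 2 := by
  have hcent := integral_centered_mul_le hf hg h0 h1 hT
  set p := ∫ y, g y ∂ν
  have hT0 : 0 ≤ T := (abs_nonneg _).trans (hT m le_rfl)
  have hn' : (0 : ℝ) < n := by exact_mod_cast hn
  have hgk : ∀ l, Measurable fun x => g (f^[l] x) := fun l =>
    hg.comp (hf.iterate l).measurable
  have hbd : ∀ y, |g y - p| ≤ 1 + p := fun y => by
    rw [abs_le]; constructor <;> linarith [h0 y, h1 y]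
  have hint : ∀ i j, Integrable (fun x => (g (f^[i] x) - p) * (g (f^[j] x) - p)) ν :=
    fun i j => Integrable.of_bound
      (((hgk i).sub_const p).mul ((hgk j).sub_const p)).aestronglyMeasurable
      ((1 + p) * (1 + p)) (ae_of_all _ fun x => by
        rw [Real.norm_eq_abs, abs_mul]
        exact mul_le_mul (hbd _) (hbd _) (abs_nonneg _) (by linarith))
  have hsq : ∀ x, (∑ i ∈ Finset.range n, (g (f^[i] x) - p)) ^ 2 =
      ∑ i ∈ Finset.range n, ∑ j ∈ Finset.range n, (g (f^[i] x) - p) * (g (f^[j] x) - p) :=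
    fun x => by rw [sq, Finset.sum_mul_sum]
  have hvar : ∫ x, (∑ i ∈ Finset.range n, (g (f^[i] x) - p)) ^ 2 ∂ν ≤
      2 * n * m * p + (n : ℝ) ^ 2 * T := by
    simp_rw [hsq]
    rw [integral_finsetSum _ fun i _ => integrable_finsetSum _ fun j _ => hint i j]
    simp_rw [integral_finsetSum _ fun j _ => hint _ j]
    exact (Finset.sum_le_sum fun i _ => Finset.sum_le_sum fun j _ => hcent i j).trans
      (sum_sum_near_le n m hp.le hT0)
  have hcheb := mul_meas_ge_le_integral_of_nonneg (μ := ν)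
    (f := fun x => (∑ i ∈ Finset.range n, (g (f^[i] x) - p)) ^ 2)
    (ae_of_all _ fun x => sq_nonneg _)
    (by
      simp_rw [hsq]
      exact integrable_finsetSum _ fun i _ => integrable_finsetSum _ fun j _ => hint i j)
    ((n * p) ^ 2)
  -- When every term vanishes, the centered sum equals `-(n * p)`, so Chebyshev is applied at
  -- exactly that deviation.
  have hsub : {x | ∀ i < n, g (f^[i] x) = 0} ⊆
      {x | (n * p) ^ 2 ≤ (∑ i ∈ Finset.range n, (g (f^[i] x) - p)) ^ 2} := by
    intro x hx
    have : ∑ i ∈ Finset.range n, (g (f^[i] x) - p) = -(n * p) := by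
      rw [Finset.sum_congr rfl fun i hi => by rw [hx i (Finset.mem_range.1 hi)]]
      simp
    rw [Set.mem_ofPred_eq, this, neg_sq]
  have hle : (n * p) ^ 2 * ν.real {x | ∀ i < n, g (f^[i] x) = 0} ≤
      2 * n * m * p + (n : ℝ) ^ 2 * T :=
    (mul_le_mul_of_nonneg_left (measureReal_mono hsub) (by positivity)).trans
      (hcheb.trans hvar)
  have heq : 2 * m / (n * p) + T / p ^ 2 = (2 * n * m * p + (n : ℝ) ^ 2 * T) / (n * p) ^ 2 := by
    field_simp
  rw [heq, le_div_iff₀ (by positivity), mul_comm]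
  exact hle

end SecondMoment

/-! ### Probabilities of hitting and missing a ball; positivity of the dimension. -/

section Hitting

variable {X : Type*} [MetricSpace X] [MeasurableSpace X] [OpensMeasurableSpace X]
  {ν : Measure X} {f : X → X} {Θ : ℕ → ℝ}

/-- The probability that an orbit segment of length `n` meets a ball. -/
theorem measureReal_hit_ball_le (hf : MeasurePreserving f ν ν) (z : X) (r : ℝ) (n : ℕ) :
    ν.real {x | ∃ i < n, dist (f^[i] x) z < r} ≤ n * ν.real (Metric.ball z r) := by
  have h : {x | ∃ i < n, dist (f^[i] x) z < r} =
      ⋃ i ∈ Finset.range n, f^[i] ⁻¹' Metric.ball z r := by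
    ext x; simp
  rw [h]
  refine (measureReal_biUnion_finset_le _ _).trans (le_of_eq ?_)
  rw [Finset.sum_congr rfl fun i _ => (hf.iterate i).measureReal_preimage
    Metric.isOpen_ball.measurableSet.nullMeasurableSet]
  simp

variable [IsProbabilityMeasure ν]

theorem DecayOfCorrelations.nonneg {X : Type*} [MetricSpace X] [MeasurableSpace X] {f : X → X}
    {ν : Measure X} {Θ : ℕ → ℝ} (h : DecayOfCorrelations f ν Θ) (n : ℕ) : 0 ≤ Θ n :=
  h.antitone.le_of_tendsto h.tendsto_zero n

/-- The probability that an orbit segment of length `n` misses a ball. -/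
theorem measureReal_miss_ball_le (hf : MeasurePreserving f ν ν) (hΘ : DecayOfCorrelations f ν Θ)
    (z : X) {r : ℝ} (hr : 0 < r) (hball : 0 < ν.real (Metric.ball z (r / 2))) {n : ℕ} (hn : 0 < n)
    (m : ℕ) :
    ν.real {x | ∀ i < n, r ≤ dist (f^[i] x) z} ≤
      2 * m / (n * ν.real (Metric.ball z (r / 2))) +
        Θ m * (1 + 2 / r) ^ 2 / ν.real (Metric.ball z (r / 2)) ^ 2 := by
  have hm : Measurable (bump z r) := (continuous_bump z hr).measurable
  have hple : ν.real (Metric.ball z (r / 2)) ≤ ∫ y, bump z r y ∂ν := by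
    rw [← integral_indicator_one (μ := ν) Metric.isOpen_ball.measurableSet]
    refine integral_mono ((integrable_const (1 : ℝ)).indicator Metric.isOpen_ball.measurableSet)
      (integrable_of_mem_unitInterval hm (bump_nonneg z r) (bump_le_one z r)) fun x => ?_
    by_cases hx : x ∈ Metric.ball z (r / 2)
    · rw [Set.indicator_of_mem hx, bump_eq_one hr hx, Pi.one_apply]
    · rw [Set.indicator_of_notMem hx]
      exact bump_nonneg z r x
  have hT : ∀ k, m ≤ k → correlation f ν k (bump z r) (bump z r) ≤ Θ m * (1 + 2 / r) ^ 2 := by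
    intro k hk
    refine (hΘ.bound _ _ (isBoundedLipschitz_bump z hr) (isBoundedLipschitz_bump z hr) k).trans ?_
    rw [mul_assoc, sq]
    have hl := lipNorm_bump_le z hr
    have hl0 := lipNorm_nonneg (bump z r)
    exact mul_le_mul (hΘ.antitone hk) (mul_le_mul hl hl hl0 (hl0.trans hl))
      (mul_nonneg hl0 hl0) (hΘ.nonneg m)
  have hsub : {x | ∀ i < n, r ≤ dist (f^[i] x) z} ⊆ {x | ∀ i < n, bump z r (f^[i] x) = 0} :=
    fun x hx i hi => bump_eq_zero hr (hx i hi)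
  refine ((measureReal_mono hsub).trans (measureReal_forall_eq_zero_le hf hm (bump_nonneg z r)
    (bump_le_one z r) hn hT (hball.trans_le hple))).trans ?_
  have hn' : (0 : ℝ) < n := by exact_mod_cast hn
  have := hΘ.nonneg m
  gcongr

/-- The first Borel–Cantelli lemma for real-valued probabilities. -/
theorem ae_eventually_notMem_of_summable {Y : Type*} [MeasurableSpace Y] {μ : Measure Y}
    [IsFiniteMeasure μ] {s : ℕ → Set Y} {a : ℕ → ℝ} (ha : Summable a)
    (h : ∀ᶠ k in atTop, μ.real (s k) ≤ a k) : ∀ᵐ x ∂μ, ∀ᶠ k in atTop, x ∉ s k := by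
  have hs : Summable fun k => μ.real (s k) := .of_norm_bounded_eventually_nat ha <| by
    filter_upwards [h] with k hk
    rwa [Real.norm_of_nonneg measureReal_nonneg]
  refine ae_eventually_notMem ?_
  convert hs.tsum_ofReal_ne_top using 3 with k
  exact (ofReal_measureReal (measure_ne_top _ _)).symm

/-- If `s ≤ 0` then `r ^ s ≥ 1` for `r ≤ 1`, so small balls keep mass at least `c`, although they
shrink to the null set `{z}`. -/
theorem BallComparable.pos {z : X} {s : ℝ} (h : BallComparable ν z s) (hz : ν {z} = 0) :
    0 < s := by
  obtain ⟨c, C, r₁, hc, hr₁, h⟩ := h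
  by_contra! hs
  have hlim : Tendsto (fun n : ℕ => ν (Metric.ball z (1 / ((n : ℝ) + 1)))) atTop
      (𝓝 (ν (⋂ n : ℕ, Metric.ball z (1 / ((n : ℝ) + 1))))) := by
    refine tendsto_measure_iInter_atTop
      (fun n => Metric.isOpen_ball.measurableSet.nullMeasurableSet) ?_ ⟨0, measure_ne_top _ _⟩
    intro a b hab
    exact Metric.ball_subset_ball (Nat.one_div_le_one_div hab)
  have hI : ⋂ n : ℕ, Metric.ball z (1 / ((n : ℝ) + 1)) = {z} := by
    ext x
    simp only [Set.mem_iInter, Metric.mem_ball, Set.mem_singleton_iff]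
    constructor
    · intro hx
      by_contra hne
      obtain ⟨n, hn⟩ := exists_nat_one_div_lt (dist_pos.2 hne)
      exact (hx n).not_gt hn
    · rintro rfl n
      rw [dist_self]; positivity
  rw [hI, hz] at hlim
  have hlim' : Tendsto (fun n : ℕ => ν.real (Metric.ball z (1 / ((n : ℝ) + 1)))) atTop (𝓝 0) :=
    (ENNReal.tendsto_toReal ENNReal.zero_ne_top).comp hlim
  have hr := tendsto_one_div_add_atTop_nhds_zero_nat (𝕜 := ℝ)
  obtain ⟨n, hn1, hn2⟩ := ((hlim'.eventually (gt_mem_nhds hc)).and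
    (hr.eventually (gt_mem_nhds hr₁))).exists
  have hpos : (0 : ℝ) < 1 / ((n : ℝ) + 1) := by positivity
  have hle : 1 / ((n : ℝ) + 1) ≤ 1 := by
    rw [div_le_one (by positivity)]; linarith [n.cast_nonneg (α := ℝ)]
  have := (h _ hpos hn2).1
  have h1 := Real.one_le_rpow_of_pos_of_le_one_of_nonpos hpos hle hs
  nlinarith

end Hitting

/-! ### Borel–Cantelli along powers of four, and interpolation. -/

section Blocks

variable {X : Type*} [MetricSpace X] [MeasurableSpace X] [OpensMeasurableSpace X]
  {ν : Measure X} [IsProbabilityMeasure ν] {f : X → X} {Θ : ℕ → ℝ} {z : X} {s : ℝ}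

/-- The segment has length `4 ^ (k + 1)` so that the bound covers every `n` with `4 ^ k ≤ n < 4 ^ (k
+ 1)`. -/
theorem ae_eventually_maxProc_le_of_summable (hf : MeasurePreserving f ν ν)
    (hball : BallComparable ν z s) {c : ℕ → ℝ} (hc : Tendsto c atTop atTop)
    (hsum : Summable fun k => (4 : ℝ) ^ (k + 1) * Real.exp (-(s * c k))) :
    ∀ᵐ x ∂ν, ∀ᶠ k in atTop, maxProc f (logObs z) (4 ^ (k + 1)) x ≤ (c k : EReal) := by
  obtain ⟨_, C, r₁, _, hr₁, h⟩ := hball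
  have hr : Tendsto (fun k => Real.exp (-c k)) atTop (𝓝 0) :=
    Real.tendsto_exp_neg_atTop_nhds_zero.comp hc
  have key := ae_eventually_notMem_of_summable (μ := ν)
    (s := fun k => {x | ∃ i < 4 ^ (k + 1), dist (f^[i] x) z < Real.exp (-c k)})
    (hsum.mul_left C) (by
      filter_upwards [hr.eventually (gt_mem_nhds hr₁)] with k hk
      refine (measureReal_hit_ball_le hf z _ _).trans ?_
      have h2 := (h _ (Real.exp_pos _) hk).2
      rw [← Real.exp_mul, show -c k * s = -(s * c k) by ring] at h2
      push_cast
      calc _ ≤ (4 : ℝ) ^ (k + 1) * (C * Real.exp (-(s * c k))) := by gcongr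
        _ = _ := by ring)
  filter_upwards [key] with x hx
  filter_upwards [hx] with k hk
  refine maxProc_logObs_le_coe fun i hi => ?_
  by_contra! hlt
  exact hk ⟨i, hi, hlt⟩

/-- The two series are the two terms of the miss probability at `r = exp (-c k)`, up to constants:
`1 / p` is at most of order `exp (s * c k)` and the squared Lipschitz norm of order `exp (2 * c k)`.
-/
theorem ae_eventually_le_maxProc_of_summable (hf : MeasurePreserving f ν ν)
    (hΘ : DecayOfCorrelations f ν Θ) (hball : BallComparable ν z s) {c : ℕ → ℝ}
    (hc : Tendsto c atTop atTop) (m : ℕ → ℕ)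
    (hsum₁ : Summable fun k => (m k : ℝ) * (Real.exp (s * c k) / 4 ^ k))
    (hsum₂ : Summable fun k => Θ (m k) * Real.exp ((2 + 2 * s) * c k)) :
    ∀ᵐ x ∂ν, ∀ᶠ k in atTop, (c k : EReal) ≤ maxProc f (logObs z) (4 ^ k) x := by
  obtain ⟨b, _, r₁, hb, hr₁, h⟩ := hball
  have hr : Tendsto (fun k => Real.exp (-c k)) atTop (𝓝 0) :=
    Real.tendsto_exp_neg_atTop_nhds_zero.comp hc
  set a : ℝ := b * (1 / 2) ^ s
  have ha : 0 < a := by positivity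
  have key := ae_eventually_notMem_of_summable (μ := ν)
    (s := fun k => {x | ∀ i < 4 ^ k, Real.exp (-c k) ≤ dist (f^[i] x) z})
    ((hsum₁.mul_left (2 / a)).add (hsum₂.mul_left (9 / a ^ 2))) (by
      filter_upwards [hr.eventually (gt_mem_nhds hr₁), hr.eventually (gt_mem_nhds one_pos)]
        with k hk hk1
      have hE : 0 < Real.exp (-c k) := Real.exp_pos _
      have h1 := (h (Real.exp (-c k) / 2) (by positivity) (by linarith)).1
      have h2 : b * (Real.exp (-c k) / 2) ^ s = a * Real.exp (-(s * c k)) := by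
        rw [div_eq_mul_one_div, Real.mul_rpow hE.le (by norm_num), ← Real.exp_mul]
        simp only [a]
        ring_nf
      rw [h2] at h1
      have hpos : 0 < a * Real.exp (-(s * c k)) := by positivity
      refine (measureReal_miss_ball_le hf hΘ z hE (hpos.trans_le h1) (by positivity) (m k)).trans ?_
      -- The radius is below `1`, so the `1` is absorbed; squaring the `3` gives the constant `9`
      -- above.
      have hL : 1 + 2 / Real.exp (-c k) ≤ 3 * Real.exp (c k) := by
        have : 1 ≤ Real.exp (c k) := by
          rw [Real.exp_neg] at hk1
          exact (inv_lt_one_iff₀.1 hk1).resolve_left (Real.exp_pos _).not_ge |>.le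
        rw [Real.exp_neg, div_inv_eq_mul]
        linarith
      have hΘ0 := hΘ.nonneg (m k)
      push_cast
      refine add_le_add ?_ ?_
      · calc 2 * (m k : ℝ) / (4 ^ k * ν.real (Metric.ball z (Real.exp (-c k) / 2)))
            ≤ 2 * (m k : ℝ) / (4 ^ k * (a * Real.exp (-(s * c k)))) := by gcongr
          _ = _ := by rw [Real.exp_neg]; field_simp
      · calc Θ (m k) * (1 + 2 / Real.exp (-c k)) ^ 2 /
              ν.real (Metric.ball z (Real.exp (-c k) / 2)) ^ 2
            ≤ Θ (m k) * (3 * Real.exp (c k)) ^ 2 / (a * Real.exp (-(s * c k))) ^ 2 := by gcongr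
          _ = _ := by
            have e : Real.exp ((2 + 2 * s) * c k) = Real.exp (c k) ^ 2 * Real.exp (s * c k) ^ 2 := by
              rw [← Real.exp_nat_mul, ← Real.exp_nat_mul, ← Real.exp_add]
              push_cast
              ring_nf
            rw [e, Real.exp_neg]
            field_simp
            ring)
  filter_upwards [key] with x hx
  filter_upwards [hx] with k hk
  by_contra hlt
  refine hk fun i hi => ?_
  by_contra! hd
  exact hlt (coe_le_maxProc_logObs hi hd.le)

theorem tendsto_log_nat_atTop : Tendsto (Nat.log 4) atTop atTop :=
  tendsto_atTop.2 fun k => by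
    filter_upwards [eventually_ge_atTop (4 ^ k)] with n hn
    exact Nat.le_log_of_pow_le (by norm_num) hn

theorem one_lt_log_four : 1 < Real.log 4 := by
  rw [show (4 : ℝ) = 2 ^ 2 by norm_num, Real.log_pow]
  push_cast
  linarith [Real.log_two_gt_d9]

theorem log_bounds_of_natLog {n : ℕ} (hn : n ≠ 0) :
    Nat.log 4 n * Real.log 4 ≤ Real.log n ∧ Real.log n ≤ (Nat.log 4 n + 1) * Real.log 4 := by
  have h1 : ((4 : ℝ) ^ Nat.log 4 n) ≤ n := by exact_mod_cast Nat.pow_log_le_self 4 hn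
  have h2 : (n : ℝ) ≤ 4 ^ (Nat.log 4 n + 1) := by
    exact_mod_cast (Nat.lt_pow_succ_log_self (by norm_num : 1 < 4) n).le
  have h0 : (0 : ℝ) < n := by exact_mod_cast Nat.pos_of_ne_zero hn
  constructor
  · rw [← Real.log_pow]; exact Real.log_le_log (by positivity) h1
  · have := Real.log_le_log h0 h2
    rw [Real.log_pow] at this
    exact_mod_cast this

theorem exp_mul_log_four (k : ℕ) : Real.exp (k * Real.log 4) = 4 ^ k := by
  rw [mul_comm, ← Real.rpow_def_of_pos (by norm_num), Real.rpow_natCast]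

theorem ae_eventually_maxProc_le (hf : MeasurePreserving f ν ν) (hball : BallComparable ν z s)
    (hs : 0 < s) {η : ℝ} (hη : 1 < η) :
    ∀ᵐ x ∂ν, ∀ᶠ n : ℕ in atTop, maxProc f (logObs z) n x ≤
      ((s⁻¹ * (Real.log n + η * Real.log (Real.log n)) : ℝ) : EReal) := by
  have hl := one_lt_log_four
  have hL : Tendsto (fun k : ℕ => (k : ℝ) * Real.log 4) atTop atTop :=
    tendsto_natCast_atTop_atTop.atTop_mul_const (by linarith)
  have hc : Tendsto (fun k : ℕ => s⁻¹ * (k * Real.log 4 + η * Real.log (k * Real.log 4)))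
      atTop atTop :=
    (hL.atTop_add_atTop ((Real.tendsto_log_atTop.comp hL).const_mul_atTop
      (by linarith))).const_mul_atTop (inv_pos.2 hs)
  have hsum : Summable fun k : ℕ => (4 : ℝ) ^ (k + 1) * Real.exp (-(s * (s⁻¹ *
      (k * Real.log 4 + η * Real.log (k * Real.log 4))))) := by
    refine .of_norm_bounded_eventually_nat
      ((Real.summable_nat_rpow_inv.2 hη).mul_left (4 * (Real.log 4 ^ η)⁻¹)) ?_
    filter_upwards [eventually_gt_atTop 0] with k hk
    have hk' : (0 : ℝ) < k := by exact_mod_cast hk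
    rw [mul_inv_cancel_left₀ hs.ne', neg_add, Real.exp_add, Real.exp_neg, exp_mul_log_four,
      Real.exp_neg, mul_comm η, ← Real.rpow_def_of_pos (by positivity),
      Real.mul_rpow hk'.le (by linarith), Real.norm_of_nonneg (by positivity)]
    apply le_of_eq
    field_simp
    ring
  filter_upwards [ae_eventually_maxProc_le_of_summable hf hball hc hsum] with x hx
  filter_upwards [tendsto_log_nat_atTop.eventually hx, eventually_ge_atTop 4] with n hn hn4
  refine (maxProc_mono f _ x (Nat.lt_pow_succ_log_self (by norm_num) n).le).trans
    (hn.trans (EReal.coe_le_coe_iff.2 ?_))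
  have hb := (log_bounds_of_natLog (by omega : n ≠ 0)).1
  have hk : (1 : ℝ) ≤ Nat.log 4 n := by
    exact_mod_cast Nat.le_log_of_pow_le (by norm_num) (by simpa using hn4)
  have hlog := Real.log_le_log (by positivity) hb
  gcongr

theorem ae_eventually_le_maxProc_of_exponential (hf : MeasurePreserving f ν ν)
    (hΘ : DecayOfCorrelations f ν Θ) (hball : BallComparable ν z s) (hs : 0 < s) {θ : ℝ}
    (hθ0 : 0 < θ) (hθ1 : θ < 1) (hO : Θ =O[atTop] fun n : ℕ => θ ^ n) :
    ∀ᵐ x ∂ν, ∀ᶠ n : ℕ in atTop,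
      ((s⁻¹ * (Real.log n - 3 * Real.log (Real.log n)) : ℝ) : EReal) ≤
        maxProc f (logObs z) n x := by
  have hl := one_lt_log_four
  have hL : Tendsto (fun k : ℕ => (k : ℝ) * Real.log 4) atTop atTop :=
    tendsto_natCast_atTop_atTop.atTop_mul_const (by linarith)
  have hdiff : Tendsto (fun t : ℝ => t - 3 * Real.log t) atTop atTop := by
    have h1 : ∀ᶠ t : ℝ in atTop, 1 / 2 * t ≤ t - 3 * Real.log t := by
      filter_upwards [Real.isLittleO_log_id_atTop.bound (by norm_num : (0 : ℝ) < 1 / 6),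
        eventually_ge_atTop 1] with t ht ht1
      have := (Real.le_norm_self _).trans ht
      rw [id, Real.norm_of_nonneg (by linarith)] at this
      linarith
    exact tendsto_atTop_mono' _ h1 (tendsto_id.const_mul_atTop (by norm_num))
  -- The final `Real.log 4` pays for comparing `log n` with `log (4 ^ k)` when `n < 4 ^ (k + 1)`.
  -- The coefficient `3` leaves a factor `k ^ (-3)`, summable even after multiplication by a gap
  -- linear in `k`.
  set c : ℕ → ℝ := fun k => s⁻¹ * ((k * Real.log 4 - 3 * Real.log (k * Real.log 4)) + Real.log 4)
    with hcdef
  have hc : Tendsto c atTop atTop :=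
    (tendsto_atTop_add_const_right _ _ (hdiff.comp hL)).const_mul_atTop (inv_pos.2 hs)
  set q : ℝ := (2 + 2 * s) * s⁻¹ with hq
  have hq0 : 0 < q := by positivity
  -- `exp ((2 + 2 * s) * c k)` grows at most like `(4 ^ q) ^ (k + 1)`; a gap with slope `K + 1` in
  -- `k` makes the decay beat it geometrically.
  obtain ⟨K, hK⟩ : ∃ K : ℕ, θ ^ K * 4 ^ q ≤ 1 / 2 := by
    have := (tendsto_pow_atTop_nhds_zero_of_lt_one hθ0.le hθ1).mul_const ((4 : ℝ) ^ q)
    rw [zero_mul] at this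
    exact (this.eventually (ge_mem_nhds (by norm_num : (0 : ℝ) < 1 / 2))).exists
  have hK' : θ ^ (K + 1) * 4 ^ q ≤ 1 / 2 := by
    refine le_trans ?_ hK
    gcongr ?_ * _
    exact pow_le_pow_of_le_one hθ0.le hθ1.le (Nat.le_succ K)
  have hm : Tendsto (fun k : ℕ => (K + 1) * (k + 1)) atTop atTop :=
    tendsto_atTop_mono (fun k => (Nat.le_succ k).trans (Nat.le_mul_of_pos_left _ K.succ_pos))
      tendsto_id
  have hsum₁ : Summable fun k : ℕ => (((K + 1) * (k + 1) : ℕ) : ℝ) *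
      (Real.exp (s * c k) / 4 ^ k) := by
    refine .of_norm_bounded_eventually_nat
      ((Real.summable_nat_pow_inv.2 (by norm_num : 1 < 2)).mul_left (8 * ((K : ℝ) + 1))) ?_
    filter_upwards [eventually_gt_atTop 0] with k hk
    have hk' : (1 : ℝ) ≤ k := by exact_mod_cast hk
    have hkl : (k : ℝ) ≤ k * Real.log 4 := le_mul_of_one_le_right (by linarith) hl.le
    have e : Real.exp (s * c k) = 4 ^ k * ((k * Real.log 4) ^ 3)⁻¹ * 4 := by
      rw [hcdef, mul_inv_cancel_left₀ hs.ne', Real.exp_add, Real.exp_log (by norm_num),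
        sub_eq_add_neg, Real.exp_add, exp_mul_log_four, Real.exp_neg]
      congr 3
      rw [mul_comm, ← Real.rpow_def_of_pos (by positivity)]
      exact_mod_cast Real.rpow_natCast _ 3
    rw [e, Real.norm_of_nonneg (by positivity)]
    push_cast
    calc ((K : ℝ) + 1) * (k + 1) * (4 ^ k * ((k * Real.log 4) ^ 3)⁻¹ * 4 / 4 ^ k)
        = ((K : ℝ) + 1) * (k + 1) * (((k * Real.log 4) ^ 3)⁻¹ * 4) := by field_simp
      _ ≤ ((K : ℝ) + 1) * (k + k) * (((k : ℝ) ^ 3)⁻¹ * 4) := by gcongr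
      _ = _ := by field_simp; ring
  have hsum₂ : Summable fun k : ℕ => Θ ((K + 1) * (k + 1)) *
      Real.exp ((2 + 2 * s) * c k) := by
    obtain ⟨A, hA⟩ := hO.bound
    refine .of_norm_bounded_eventually_nat (summable_geometric_two.mul_left (|A| * 1)) ?_
    filter_upwards [hm.eventually hA, eventually_gt_atTop 0] with k hk hk0
    have hk' : (1 : ℝ) ≤ k := by exact_mod_cast hk0
    have hlog : 0 ≤ Real.log (k * Real.log 4) := Real.log_nonneg (by nlinarith)
    have e : Real.exp ((2 + 2 * s) * c k) ≤ (4 ^ q) ^ (k + 1) := by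
      rw [← Real.rpow_natCast, ← Real.rpow_mul (by norm_num),
        Real.rpow_def_of_pos (by norm_num), hcdef]
      simp only
      rw [← mul_assoc, ← hq]
      refine Real.exp_le_exp.2 ?_
      push_cast
      nlinarith [mul_nonneg hq0.le hlog]
    rw [norm_mul, Real.norm_of_nonneg (Real.exp_pos _).le, mul_one]
    rw [Real.norm_of_nonneg (by positivity : 0 ≤ θ ^ ((K + 1) * (k + 1)))] at hk
    calc ‖Θ ((K + 1) * (k + 1))‖ * Real.exp ((2 + 2 * s) * c k)
        ≤ (|A| * θ ^ ((K + 1) * (k + 1))) * (4 ^ q) ^ (k + 1) := by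
          refine mul_le_mul (hk.trans ?_) e (Real.exp_pos _).le (by positivity)
          gcongr
          exact le_abs_self A
      _ = |A| * (θ ^ (K + 1) * 4 ^ q) ^ (k + 1) := by rw [pow_mul]; ring
      _ ≤ |A| * (1 / 2) ^ (k + 1) := by gcongr
      _ ≤ |A| * (1 / 2) ^ k := by
          gcongr ?_ * ?_
          exact pow_le_pow_of_le_one (by norm_num) (by norm_num) (Nat.le_succ k)
  filter_upwards [ae_eventually_le_maxProc_of_summable hf hΘ hball hc _ hsum₁ hsum₂] with x hx
  filter_upwards [tendsto_log_nat_atTop.eventually hx, eventually_ge_atTop 4] with n hn hn4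
  refine ((EReal.coe_le_coe_iff.2 ?_).trans hn).trans
    (maxProc_mono f _ x (Nat.pow_log_le_self 4 (by omega)))
  obtain ⟨hb1, hb2⟩ := log_bounds_of_natLog (by omega : n ≠ 0)
  have hk : (1 : ℝ) ≤ Nat.log 4 n := by
    exact_mod_cast Nat.le_log_of_pow_le (by norm_num) (by simpa using hn4)
  have hlog := Real.log_le_log (by positivity) hb1
  refine mul_le_mul_of_nonneg_left ?_ (inv_pos.2 hs).le
  linarith

theorem exists_ae_eventually_le_maxProc_of_polynomial (hf : MeasurePreserving f ν ν)
    (hΘ : DecayOfCorrelations f ν Θ) (hball : BallComparable ν z s) (hs : 0 < s) {ζ : ℝ}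
    (hζ : 0 < ζ) (hO : Θ =O[atTop] fun n : ℕ => (n : ℝ) ^ (-ζ)) :
    ∃ β : ℝ, 0 < β ∧ ∀ᵐ x ∂ν, ∀ᶠ n : ℕ in atTop,
      ((s⁻¹ * (β * Real.log n) : ℝ) : EReal) ≤ maxProc f (logObs z) n x := by
  have hl := one_lt_log_four
  set q : ℝ := (2 + 2 * s) * s⁻¹ with hq
  have hq0 : 0 < q := by positivity
  -- With gap `2 ^ k`, the bound `1 / 4` makes the first series of order `2 ^ (-k / 2)`, and `ζ / (4
  -- * q)` makes the second of order `2 ^ (-ζ * k / 2)`.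
  set β : ℝ := min (1 / 4) (ζ / (4 * q)) with hβ
  have hβ0 : 0 < β := lt_min (by norm_num) (by positivity)
  have hβ1 : β ≤ 1 / 4 := min_le_left _ _
  have hβ2 : q * β ≤ ζ / 4 := by
    have : β ≤ ζ / (4 * q) := min_le_right _ _
    rw [le_div_iff₀ (by positivity)] at this
    linarith
  refine ⟨β, hβ0, ?_⟩
  -- The factor `k + 1` rather than `k` makes `c k` dominate the target for all `n < 4 ^ (k + 1)`.
  set c : ℕ → ℝ := fun k => s⁻¹ * (β * ((k + 1) * Real.log 4)) with hcdef
  have hc : Tendsto c atTop atTop :=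
    (((tendsto_atTop_add_const_right _ 1 tendsto_natCast_atTop_atTop).atTop_mul_const
      (by linarith)).const_mul_atTop hβ0).const_mul_atTop (inv_pos.2 hs)
  have h24 : Real.log 4 = 2 * Real.log 2 := by
    rw [show (4 : ℝ) = 2 ^ 2 by norm_num, Real.log_pow]; push_cast; rfl
  have hl2 : 0 < Real.log 2 := Real.log_pos (by norm_num)
  have hgeom : ∀ a : ℝ, 0 < a → Summable fun k : ℕ => Real.exp (-a * k) := by
    intro a ha
    have := Real.summable_exp_nat_mul_iff.2 (neg_lt_zero.2 ha)
    simpa only [mul_comm] using this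
  have hexp2 : ∀ k : ℕ, (2 : ℝ) ^ k = Real.exp (k * Real.log 2) := fun k => by
    rw [mul_comm, ← Real.rpow_def_of_pos (by norm_num), Real.rpow_natCast]
  have hsum₁ : Summable fun k : ℕ => ((2 ^ k : ℕ) : ℝ) * (Real.exp (s * c k) / 4 ^ k) := by
    refine .of_norm_bounded ((hgeom (Real.log 2 / 2) (by positivity)).mul_left
      (Real.exp (Real.log 2))) fun k => ?_
    rw [Real.norm_of_nonneg (by positivity), Nat.cast_pow, Nat.cast_ofNat, hexp2,
      ← exp_mul_log_four, ← Real.exp_sub, ← Real.exp_add, ← Real.exp_add, Real.exp_le_exp,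
      hcdef, mul_inv_cancel_left₀ hs.ne', h24]
    have : β * ((k + 1) * (2 * Real.log 2)) ≤ 1 / 4 * ((k + 1) * (2 * Real.log 2)) := by gcongr
    linarith
  have hm : Tendsto (fun k : ℕ => 2 ^ k) atTop atTop :=
    tendsto_pow_atTop_atTop_of_one_lt (by norm_num)
  have hsum₂ : Summable fun k : ℕ => Θ (2 ^ k) * Real.exp ((2 + 2 * s) * c k) := by
    obtain ⟨A, hA⟩ := hO.bound
    refine .of_norm_bounded_eventually_nat
      ((hgeom (ζ / 2 * Real.log 2) (by positivity)).mul_left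
        (|A| * Real.exp (ζ / 2 * Real.log 2))) ?_
    filter_upwards [hm.eventually hA] with k hk
    have e : ((2 ^ k : ℕ) : ℝ) ^ (-ζ) = Real.exp (-(ζ * (k * Real.log 2))) := by
      rw [Nat.cast_pow, Nat.cast_ofNat, hexp2, ← Real.exp_mul]
      ring_nf
    rw [e, Real.norm_of_nonneg (Real.exp_pos _).le] at hk
    rw [norm_mul, Real.norm_of_nonneg (Real.exp_pos _).le]
    calc ‖Θ (2 ^ k)‖ * Real.exp ((2 + 2 * s) * c k)
        ≤ (|A| * Real.exp (-(ζ * (k * Real.log 2)))) * Real.exp ((2 + 2 * s) * c k) := by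
          gcongr
          exact hk.trans (by gcongr; exact le_abs_self A)
      _ ≤ _ := by
          rw [mul_assoc, mul_assoc, ← Real.exp_add, ← Real.exp_add]
          refine mul_le_mul_of_nonneg_left (Real.exp_le_exp.2 ?_) (abs_nonneg A)
          rw [hcdef, h24]
          simp only
          rw [← mul_assoc (2 + 2 * s), ← hq, ← mul_assoc q]
          have : q * β * ((k + 1) * (2 * Real.log 2)) ≤
            ζ / 4 * ((k + 1) * (2 * Real.log 2)) := by gcongr
          linarith
  filter_upwards [ae_eventually_le_maxProc_of_summable hf hΘ hball hc _ hsum₁ hsum₂] with x hx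
  filter_upwards [tendsto_log_nat_atTop.eventually hx, eventually_ge_atTop 4] with n hn hn4
  refine ((EReal.coe_le_coe_iff.2 ?_).trans hn).trans
    (maxProc_mono f _ x (Nat.pow_log_le_self 4 (by omega)))
  have hb := (log_bounds_of_natLog (by omega : n ≠ 0)).2
  simp only [hcdef]
  gcongr

end Blocks

theorem measure_singleton_eq_zero_of_map_absolutelyContinuous {d : ℕ} (hd : 1 ≤ d)
    {X : Set (EuclideanSpace ℝ (Fin d))} {ν : Measure X}
    (hac : ν.map (Subtype.val : X → EuclideanSpace ℝ (Fin d)) ≪ volume) (z : X) :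
    ν {z} = 0 := by
  -- Positive dimension is what makes points null for Lebesgue measure.
  have : Nonempty (Fin d) := ⟨⟨0, hd⟩⟩
  have h : ν.map (Subtype.val : X → EuclideanSpace ℝ (Fin d)) {(z : EuclideanSpace ℝ (Fin d))} = 0 :=
    hac (measure_singleton _)
  rw [Measure.map_apply measurable_subtype_coe (measurableSet_singleton _)] at h
  exact measure_mono_null (by rintro x rfl; rfl) h

end MaxProcess

theorem theorem2p2 (d : ℕ) (hd : 1 ≤ d) (X : Set (EuclideanSpace ℝ (Fin d)))
    (f : X → X) (ν : Measure X) [IsProbabilityMeasure ν] (hf : Ergodic f ν)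
    (hac : ν.map (Subtype.val : X → EuclideanSpace ℝ (Fin d)) ≪ volume)
    (z : X) (δ : ℝ) (hA2 : MaxProcess.AnnulusRegular ν z δ)
    (dν : ℝ) (hdim : MaxProcess.HasLocalDim ν z dν)
    (hball : MaxProcess.BallComparable ν z dν)
    (Θ : ℕ → ℝ) (hA1 : MaxProcess.DecayOfCorrelations f ν Θ) :
    ((∃ θ₀ : ℝ, 0 < θ₀ ∧ θ₀ < 1 ∧ Θ =O[atTop] fun n : ℕ => θ₀ ^ n) →
      ∃ β : ℝ, 0 < β ∧ ∀ η : ℝ, 1 < η →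
        ∀ᵐ x ∂ν, ∀ᶠ n : ℕ in atTop,
          ((dν⁻¹ * (Real.log n - β * Real.log (Real.log n)) : ℝ) : EReal) ≤
              MaxProcess.maxProc f (MaxProcess.logObs z) n x ∧
            MaxProcess.maxProc f (MaxProcess.logObs z) n x ≤
              ((dν⁻¹ * (Real.log n + η * Real.log (Real.log n)) : ℝ) : EReal)) ∧
    (∀ ζ : ℝ, 2 * δ⁻¹ < ζ → (Θ =O[atTop] fun n : ℕ => (n : ℝ) ^ (-ζ)) →
      ∃ β : ℝ, 0 < β ∧ ∀ η : ℝ, 1 < η →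
        ∀ᵐ x ∂ν, ∀ᶠ n : ℕ in atTop,
          ((dν⁻¹ * (β * Real.log n) : ℝ) : EReal) ≤
              MaxProcess.maxProc f (MaxProcess.logObs z) n x ∧
            MaxProcess.maxProc f (MaxProcess.logObs z) n x ≤
              ((dν⁻¹ * (Real.log n + η * Real.log (Real.log n)) : ℝ) : EReal)) := by
  have hs : 0 < dν := hball.pos
    (MaxProcess.measure_singleton_eq_zero_of_map_absolutelyContinuous hd hac z)
  have hmp := hf.toMeasurePreserving
  refine ⟨fun ⟨θ, hθ0, hθ1, hO⟩ => ⟨3, by norm_num, fun η hη => ?_⟩, fun ζ hζ hO => ?_⟩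
  · filter_upwards [MaxProcess.ae_eventually_maxProc_le hmp hball hs hη,
      MaxProcess.ae_eventually_le_maxProc_of_exponential hmp hA1 hball hs hθ0 hθ1 hO] with x h1 h2
    exact h2.and h1
  · have hδ := hA2.1
    obtain ⟨β, hβ, h2⟩ := MaxProcess.exists_ae_eventually_le_maxProc_of_polynomial hmp hA1 hball hs
      ((by positivity : 0 < 2 * δ⁻¹).trans hζ) hO
    refine ⟨β, hβ, fun η hη => ?_⟩
    filter_upwards [MaxProcess.ae_eventually_maxProc_le hmp hball hs hη, h2] with x h1 h2
    exact h2.and h1
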